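/- A finite hypergraph $G$ consists of a finite vertex set $V(G)$ and a set $E(G)$ of subsets of $V(G)$. For a finite set $R$ of non-negative integers, $G$ is an $R$-graph if $|e|\in R$ for every $e\in E(G)$. If $G$ has $n$ vertices, let $h_n(G)=\sum_{e\in E(G)}\binom{n}{|e|}^{-1}$. A subgraph of $G$ is a hypergraph $H$ with $V(H)\subseteq V(G)$ and $E(H)\subseteq E(G)$. A value $\alpha\in[0,|R|]$ is a *jump* for $R$ if there is $c>0$ such that for every $\varepsilon>0$ and every integer $t\ge\max R$ there is $n_0$ such that every $R$-graph $G$ on $n\ge n_0$ vertices with $h_n(G)\ge\alpha+\varepsilon$ has a subgraph $H$ on $t$ vertices with $h_t(H)\ge\alpha+c$. A value $\alpha\in[0,|R|]$ is a *strong jump* for $R$ if there is $c>0$ such that for every integer $t\ge\max R$ there is $n_0$ such that every $R$-graph $G$ on $n\ge n_0$ vertices with $h_n(G)\ge\alpha-c$ has a subgraph $H$ on $t$ vertices with $h_t(H)\ge\alpha+c$. A *weak jump* is a jump that is not a strong jump. **Theorem.** Every $\alpha\in[0,2]$ is a jump for $R=\{1,2\}$. The weak jumps for $\{1,2\}$ are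 precisely the values $$0,\qquad \frac{k}{k+1}\ (k\ge 1),\qquad 1,\qquad 1+\frac{k}{4(k+1)}\ (k\ge 1),\qquad \frac54,\qquad \frac{2k+1}{k+1}\ (k\ge 1),\qquad 2,$$ where $k$ runs over the positive integers. Every other value in $[0,2]$ is a strong jump for $\{1,2\}$. -/

import Mathlib

/-- A finite hypergraph with vertices drawn from the type `V`: a finite vertex set together with
a set of edges, each of which is a subset of the vertex set. -/
structure FinHypergraph (V : Type*) where
  /-- the vertex set -/
  verts : Finset V
  /-- the edge set -/
  edges : Finset (Finset V)
  /-- every edge consists of vertices -/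
  edge_subset : ∀ e ∈ edges, e ⊆ verts

namespace FinHypergraph

/-- `G` is an `R`-graph: every edge size of `G` lies in `R`. -/
def IsRGraph {V : Type*} (R : Finset ℕ) (G : FinHypergraph V) : Prop :=
  ∀ e ∈ G.edges, e.card ∈ R

/-- `H` is a (not necessarily induced) subgraph of `G`. -/
def IsSubgraph {V : Type*} (H G : FinHypergraph V) : Prop :=
  H.verts ⊆ G.verts ∧ H.edges ⊆ G.edges

/-- The Lubell function `h_n(G) = ∑_{e ∈ E(G)} 1 / (n choose |e|)`, where `n` is the number of
vertices of `G`. -/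
noncomputable def lubell {V : Type*} (G : FinHypergraph V) : ℝ :=
  ∑ e ∈ G.edges, 1 / (G.verts.card.choose e.card : ℝ)

end FinHypergraph

/-- `α ∈ [0, |R|]` is a jump for the finite set `R` of edge sizes. -/
def IsJump (R : Finset ℕ) (α : ℝ) : Prop :=
  α ∈ Set.Icc (0 : ℝ) (R.card : ℝ) ∧
  ∃ c : ℝ, 0 < c ∧ ∀ ε : ℝ, 0 < ε → ∀ t : ℕ, (∀ r ∈ R, r ≤ t) →
    ∃ n₀ : ℕ, ∀ n : ℕ, n₀ ≤ n → ∀ (V : Type) (G : FinHypergraph V),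
      G.IsRGraph R → G.verts.card = n → α + ε ≤ G.lubell →
        ∃ H : FinHypergraph V, H.IsSubgraph G ∧ H.verts.card = t ∧ α + c ≤ H.lubell

/-- `α ∈ [0, |R|]` is a strong jump for the finite set `R` of edge sizes. -/
def IsStrongJump (R : Finset ℕ) (α : ℝ) : Prop :=
  α ∈ Set.Icc (0 : ℝ) (R.card : ℝ) ∧
  ∃ c : ℝ, 0 < c ∧ ∀ t : ℕ, (∀ r ∈ R, r ≤ t) →
    ∃ n₀ : ℕ, ∀ n : ℕ, n₀ ≤ n → ∀ (V : Type) (G : FinHypergraph V),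
      G.IsRGraph R → G.verts.card = n → α - c ≤ G.lubell →
        ∃ H : FinHypergraph V, H.IsSubgraph G ∧ H.verts.card = t ∧ α + c ≤ H.lubell

/-- A weak jump is a jump that is not a strong jump. -/
def IsWeakJump (R : Finset ℕ) (α : ℝ) : Prop :=
  IsJump R α ∧ ¬ IsStrongJump R α

/-- The values `0`, `k/(k+1)`, `1`, `1 + k/(4(k+1))`, `5/4`, `(2k+1)/(k+1)`, `2`, where `k`
runs over the positive integers. -/
def weakJumpValues : Set ℝ :=
  {α | α = 0 ∨ (∃ k : ℕ, 1 ≤ k ∧ α = (k : ℝ) / ((k : ℝ) + 1)) ∨ α = 1 ∨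
    (∃ k : ℕ, 1 ≤ k ∧ α = 1 + (k : ℝ) / (4 * ((k : ℝ) + 1))) ∨ α = 5 / 4 ∨
    (∃ k : ℕ, 1 ≤ k ∧ α = (2 * (k : ℝ) + 1) / ((k : ℝ) + 1)) ∨ α = 2}

/-!
A `{1, 2}`-graph is a graph `Γ` with a set `A` of marked vertices (the edges of size one), and up to
lower order terms its Lubell function is the value at uniform weights of the Lagrange polynomial
`∑ v ∈ A, x v + ∑ (u, v) adjacent, x u * x v`. On non-adjacent pairs this polynomial is affine along
`x u + x v = const`, so its maximum is attained on a clique (`exists_isClique_lagrange_le`). For a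
clique with `a` marked and `b` unmarked vertices the maximum is `cliqueDensity a b`, which equals
`1 - 1 / b` for `a = 0`, `1 + b / (4 * (b + 1))` for `a = 1`, and `2 - 1 / a` for `a ≥ 2`. The set of
these numbers is a union of three monotone sequences with limits `1`, `5 / 4` and `2`, hence
well-ordered, and `weakJumpValues` is its closure.

The main step, `exists_isSubgraph_lubell_ge`, says that a large `{1, 2}`-graph whose Lubell function
exceeds `γ` by a fixed amount has subgraphs of every size whose Lubell function is at least the next
clique density above `γ`. A positive proportion of the `m`-tuples of vertices induces a pattern with
Lagrangian exceeding `γ` (`le_sum_sampleDensity`), many of them induce the same pattern, and by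
Erdős's theorem on complete `m`-partite systems of tuples (`exists_box_of_density`) the graph
contains a blow-up of this pattern. The pattern contains a clique of density exceeding `γ`; the
optimally weighted blow-up of the clique attains its density
(`cliqueDensity_le_markedLubell_biUnion`), and averaging over vertex deletions brings the number of
vertices down to the required one.

So every `α` is a jump, because there is a gap above `α` in the set of clique densities, and every
`α` outside its closure is a strong jump. Conversely, blow-ups of a clique contain only cliques
that are no larger, so their large subgraphs are not noticeably denser than the clique density; hence
no point of the closure is a strong jump.
-/

section
open Filter Topology

/-! ### Densities of complete patterns -/

/-- The maximum of the Lubell-type density over all blow-ups of a clique with `a` marked and `b`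
unmarked vertices, i.e. the maximum of `s + 1 - s² / a - (1 - s)² / b` over `s ∈ [0, 1]`, where `s`
is the weight of the marked part (and an empty part has weight `0`). For `a ≥ 2` the maximum is
attained with weight `0` on the unmarked vertices, so that the value does not depend on `b`. The pair
`a = b = 0` is meaningless and is excluded wherever the value matters. -/
noncomputable def cliqueDensity (a b : ℕ) : ℝ :=
  if a = 0 then 1 - 1 / b else if a = 1 then 1 + b / (4 * (b + 1)) else 2 - 1 / a

lemma cliqueDensity_zero (b : ℕ) : cliqueDensity 0 b = 1 - 1 / b := by simp [cliqueDensity]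

lemma cliqueDensity_one (b : ℕ) : cliqueDensity 1 b = 1 + b / (4 * (b + 1)) := by
  simp [cliqueDensity]

lemma cliqueDensity_of_two_le {a : ℕ} (ha : 2 ≤ a) (b : ℕ) : cliqueDensity a b = 2 - 1 / a := by
  rw [cliqueDensity, if_neg (by omega), if_neg (by omega)]

/-- The density of a weighted clique is at most `cliqueDensity`: here `s` is the weight of the
marked part, and `p`, `q` are the sums of the squared weights of the two parts. -/
lemma le_cliqueDensity {a b : ℕ} {s p q : ℝ} (hs1 : s ≤ 1)
    (hp0 : 0 ≤ p) (hq0 : 0 ≤ q) (hp : s ^ 2 ≤ a * p) (hq : (1 - s) ^ 2 ≤ b * q) :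
    s + 1 - p - q ≤ cliqueDensity a b := by
  rcases Nat.lt_or_ge a 2 with ha | ha
  · interval_cases a
    · have hs : s = 0 := by
        have : s ^ 2 ≤ 0 := by simpa using hp
        exact pow_eq_zero_iff (two_ne_zero) |>.1 (le_antisymm this (sq_nonneg s))
      subst hs
      rw [cliqueDensity_zero]
      have hb : (0 : ℝ) < b := by
        rcases Nat.eq_zero_or_pos b with rfl | h
        · norm_num at hq
        · exact_mod_cast h
      have : 1 / (b : ℝ) ≤ q := by rw [div_le_iff₀ hb]; linarith
      linarith
    · rw [cliqueDensity_one]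
      have hb : (0 : ℝ) ≤ b := by positivity
      have hp' : s ^ 2 ≤ p := by simpa using hp
      suffices h : s - s ^ 2 - q ≤ b / (4 * (b + 1)) by linarith
      rw [le_div_iff₀ (by positivity)]
      rcases Nat.eq_zero_or_pos b with rfl | h
      · have : s = 1 := by
          have h0 : (1 - s) ^ 2 ≤ 0 := by simpa using hq
          have := pow_eq_zero_iff (two_ne_zero) |>.1 (le_antisymm h0 (sq_nonneg (1 - s)))
          linarith
        subst this
        norm_num
        linarith
      · have hb : (0 : ℝ) < b := by exact_mod_cast h
        have key : b * ((s - s ^ 2 - q) * (4 * (b + 1))) ≤ b * b := by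
          nlinarith [sq_nonneg (2 * (1 - s) * (b + 1) - b)]
        exact le_of_mul_le_mul_left key hb
  · rw [cliqueDensity_of_two_le ha]
    have ha' : (2 : ℝ) ≤ a := by exact_mod_cast ha
    have : 1 / (a : ℝ) ≤ p + 1 - s := by
      rw [div_le_iff₀ (by linarith)]
      nlinarith
    linarith

lemma cliqueDensity_mono {a b a' b' : ℕ} (h : 1 ≤ a + b) (ha : a ≤ a') (hb : b ≤ b') :
    cliqueDensity a b ≤ cliqueDensity a' b' := by
  have hfrac : ∀ c : ℕ, (0 : ℝ) ≤ c / (4 * (c + 1)) ∧ (c : ℝ) / (4 * (c + 1)) ≤ 1 / 4 := fun c =>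
    ⟨by positivity, by rw [div_le_div_iff₀ (by positivity) (by norm_num)]; linarith⟩
  have hinv : ∀ c : ℕ, 2 ≤ c → 1 / (c : ℝ) ≤ 1 / 2 := fun c hc =>
    one_div_le_one_div_of_le (by norm_num) (by exact_mod_cast hc)
  rcases Nat.lt_or_ge a 2 with h2 | h2
  · interval_cases a
    · rw [cliqueDensity_zero]
      have hb0 : (0 : ℝ) < b := by exact_mod_cast (by omega : 0 < b)
      have hb1 : 0 ≤ 1 / (b : ℝ) := by positivity
      rcases Nat.lt_or_ge a' 2 with h2 | h2
      · interval_cases a'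
        · rw [cliqueDensity_zero]
          have := one_div_le_one_div_of_le hb0 (show (b : ℝ) ≤ b' by exact_mod_cast hb)
          linarith
        · rw [cliqueDensity_one]
          linarith [(hfrac b').1]
      · rw [cliqueDensity_of_two_le h2]
        linarith [hinv a' h2]
    · rw [cliqueDensity_one]
      rcases Nat.lt_or_ge a' 2 with h2 | h2
      · obtain rfl : a' = 1 := by omega
        rw [cliqueDensity_one]
        have : (b : ℝ) ≤ b' := by exact_mod_cast hb
        gcongr 1 + ?_
        rw [div_le_div_iff₀ (by positivity) (by positivity)]
        nlinarith
      · rw [cliqueDensity_of_two_le h2]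
        linarith [hinv a' h2, (hfrac b).2]
  · rw [cliqueDensity_of_two_le h2, cliqueDensity_of_two_le (h2.trans ha)]
    have := one_div_le_one_div_of_le (show (0 : ℝ) < a by exact_mod_cast (by omega : 0 < a))
      (show (a : ℝ) ≤ a' by exact_mod_cast ha)
    linarith

/-- A monotone sequence of reals has a gap immediately above every real number. -/
lemma Monotone.exists_gap_above {u : ℕ → ℝ} (hu : Monotone u) (α : ℝ) :
    ∃ c > 0, ∀ k, α < u k → α + c ≤ u k := by
  classical
  by_cases h : ∃ k, α < u k
  · refine ⟨u (Nat.find h) - α, sub_pos.2 (Nat.find_spec h), fun k hk => ?_⟩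
    have := hu (Nat.find_min' h hk)
    linarith
  · exact ⟨1, one_pos, fun k hk => (h ⟨k, hk⟩).elim⟩

/-- The values of `cliqueDensity` are well-ordered: there is a gap immediately above every real. -/
lemma exists_gap_above_cliqueDensity (α : ℝ) :
    ∃ c > 0, ∀ a b : ℕ, 1 ≤ a + b → α < cliqueDensity a b → α + c ≤ cliqueDensity a b := by
  have h0 : Monotone fun k => cliqueDensity 0 (k + 1) := fun k l h =>
    cliqueDensity_mono (by omega) le_rfl (by omega)
  have h1 : Monotone fun k => cliqueDensity 1 k := fun k l h =>
    cliqueDensity_mono (by omega) le_rfl h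
  have h2 : Monotone fun k => cliqueDensity (k + 2) 0 := fun k l h =>
    cliqueDensity_mono (by omega) (by omega) le_rfl
  obtain ⟨c₀, hc₀, H₀⟩ := h0.exists_gap_above α
  obtain ⟨c₁, hc₁, H₁⟩ := h1.exists_gap_above α
  obtain ⟨c₂, hc₂, H₂⟩ := h2.exists_gap_above α
  refine ⟨min c₀ (min c₁ c₂), by positivity, fun a b hab h => ?_⟩
  have m0 := min_le_left c₀ (min c₁ c₂)
  have m1 := (min_le_right c₀ (min c₁ c₂)).trans (min_le_left _ _)
  have m2 := (min_le_right c₀ (min c₁ c₂)).trans (min_le_right _ _)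
  match a with
  | 0 =>
    obtain ⟨k, rfl⟩ : ∃ k, b = k + 1 := ⟨b - 1, by omega⟩
    linarith [H₀ k h]
  | 1 => linarith [H₁ b h]
  | a + 2 =>
    have e : cliqueDensity (a + 2) b = cliqueDensity (a + 2) 0 := by
      rw [cliqueDensity_of_two_le (by omega), cliqueDensity_of_two_le (by omega)]
    rw [e] at h ⊢
    linarith [H₂ a h]

lemma cliqueDensity_mem_weakJumpValues {a b : ℕ} (h : 1 ≤ a + b) :
    cliqueDensity a b ∈ weakJumpValues := by
  match a, b, h with
  | 0, 1, _ => left; simp [cliqueDensity_zero]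
  | 0, b + 2, _ =>
    refine Or.inr (Or.inl ⟨b + 1, by omega, ?_⟩)
    rw [cliqueDensity_zero]; push_cast; field_simp; ring
  | 1, 0, _ => right; right; left; simp [cliqueDensity_one]
  | 1, b + 1, _ =>
    exact Or.inr (Or.inr (Or.inr (Or.inl ⟨b + 1, by omega, cliqueDensity_one _⟩)))
  | a + 2, b, _ =>
    refine Or.inr (Or.inr (Or.inr (Or.inr (Or.inr (Or.inl ⟨a + 1, by omega, ?_⟩)))))
    rw [cliqueDensity_of_two_le (by omega)]; push_cast; field_simp; ring

lemma tendsto_cliqueDensity_zero : Tendsto (fun k => cliqueDensity 0 (k + 1)) atTop (𝓝 1) := by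
  simp only [cliqueDensity_zero]
  have := (tendsto_one_div_add_atTop_nhds_zero_nat (𝕜 := ℝ)).const_sub 1
  simpa using this

lemma tendsto_cliqueDensity_one : Tendsto (fun k => cliqueDensity 1 k) atTop (𝓝 (5 / 4)) := by
  have h := ((tendsto_one_div_add_atTop_nhds_zero_nat (𝕜 := ℝ)).const_mul (1 / 4)).const_sub (5 / 4)
  rw [mul_zero, sub_zero] at h
  refine h.congr fun k => ?_
  rw [cliqueDensity_one]; field_simp; ring

lemma tendsto_cliqueDensity_add_two :
    Tendsto (fun k => cliqueDensity (k + 2) 0) atTop (𝓝 2) := by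
  have h := ((tendsto_add_atTop_iff_nat 1).2
    (tendsto_one_div_add_atTop_nhds_zero_nat (𝕜 := ℝ))).const_sub 2
  rw [sub_zero] at h
  refine h.congr fun k => ?_
  rw [cliqueDensity_of_two_le (by omega)]; push_cast; ring

lemma weakJumpValues_eq : weakJumpValues =
    insert 1 (Set.range fun k => cliqueDensity 0 (k + 1)) ∪
      (insert (5 / 4) (Set.range fun k => cliqueDensity 1 k) ∪
        insert 2 (Set.range fun k => cliqueDensity (k + 2) 0)) := by
  ext α
  constructor
  · rintro (h | ⟨k, hk, h⟩ | h | ⟨k, hk, h⟩ | h | ⟨k, hk, h⟩ | h)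
    · exact Or.inl (Or.inr ⟨0, by simp [cliqueDensity_zero, h]⟩)
    · refine Or.inl (Or.inr ⟨k, ?_⟩)
      simp only [h, cliqueDensity_zero]; push_cast; field_simp; ring
    · exact Or.inl (Or.inl h)
    · exact Or.inr (Or.inl (Or.inr ⟨k, by simp only [h, cliqueDensity_one]⟩))
    · exact Or.inr (Or.inl (Or.inl h))
    · obtain ⟨l, rfl⟩ : ∃ l, k = l + 1 := ⟨k - 1, by omega⟩
      refine Or.inr (Or.inr (Or.inr ⟨l, ?_⟩))
      simp only [h, cliqueDensity_of_two_le (show 2 ≤ l + 2 by omega)]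
      push_cast; field_simp; ring
    · exact Or.inr (Or.inr (Or.inl h))
  · rintro ((rfl | ⟨k, rfl⟩) | (rfl | ⟨k, rfl⟩) | (rfl | ⟨k, rfl⟩))
    · exact Or.inr (Or.inr (Or.inl rfl))
    · exact cliqueDensity_mem_weakJumpValues (by omega)
    · exact Or.inr (Or.inr (Or.inr (Or.inr (Or.inl rfl))))
    · exact cliqueDensity_mem_weakJumpValues (by omega)
    · exact Or.inr (Or.inr (Or.inr (Or.inr (Or.inr (Or.inr rfl)))))
    · exact cliqueDensity_mem_weakJumpValues (by omega)

lemma isClosed_weakJumpValues : IsClosed weakJumpValues := by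
  rw [weakJumpValues_eq]
  exact (tendsto_cliqueDensity_zero.isCompact_insert_range.union
    (tendsto_cliqueDensity_one.isCompact_insert_range.union
      tendsto_cliqueDensity_add_two.isCompact_insert_range)).isClosed

/-- Every weak jump value is approximated by densities of finite cliques. -/
lemma exists_cliqueDensity_near {α : ℝ} (hα : α ∈ weakJumpValues) {δ : ℝ} (hδ : 0 < δ) :
    ∃ a b : ℕ, 1 ≤ a + b ∧ |cliqueDensity a b - α| < δ := by
  have key : ∀ (u : ℕ → ℝ) (L : ℝ), Tendsto u atTop (𝓝 L) → ∃ k, |u k - L| < δ := fun u L hu => by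
    obtain ⟨k, hk⟩ := Metric.tendsto_atTop.1 hu δ hδ
    exact ⟨k, by simpa [Real.dist_eq] using hk k le_rfl⟩
  rw [weakJumpValues_eq] at hα
  rcases hα with (rfl | ⟨k, rfl⟩) | (rfl | ⟨k, rfl⟩) | (rfl | ⟨k, rfl⟩)
  · obtain ⟨k, hk⟩ := key _ _ tendsto_cliqueDensity_zero
    exact ⟨0, k + 1, by omega, hk⟩
  · exact ⟨0, k + 1, by omega, by simpa using hδ⟩
  · obtain ⟨k, hk⟩ := key _ _ tendsto_cliqueDensity_one
    exact ⟨1, k, by omega, hk⟩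
  · exact ⟨1, k, by omega, by simpa using hδ⟩
  · obtain ⟨k, hk⟩ := key _ _ tendsto_cliqueDensity_add_two
    exact ⟨k + 2, 0, by omega, hk⟩
  · exact ⟨k + 2, 0, by omega, by simpa using hδ⟩

lemma weakJumpValues_subset_Icc : weakJumpValues ⊆ Set.Icc 0 2 := by
  have h : ∀ a b : ℕ, 1 ≤ a + b → cliqueDensity a b ∈ Set.Icc (0 : ℝ) 2 := fun a b hab => by
    constructor
    · rcases Nat.eq_zero_or_pos a with rfl | ha
      · have := cliqueDensity_mono (a := 0) (b := 1) (a' := 0) (b' := b) le_rfl le_rfl (by omega)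
        rwa [cliqueDensity_zero, Nat.cast_one, div_one, sub_self] at this
      · have := cliqueDensity_mono (a := 1) (b := 0) (a' := a) (b' := b) le_rfl ha (by omega)
        rw [cliqueDensity_one] at this
        norm_num at this
        linarith
    · refine (cliqueDensity_mono (a' := a + 2) hab (by omega) le_rfl).trans ?_
      rw [cliqueDensity_of_two_le (by omega)]
      have : (0 : ℝ) ≤ 1 / ((a + 2 : ℕ) : ℝ) := by positivity
      linarith
  rw [weakJumpValues_eq]
  rintro _ ((rfl | ⟨k, rfl⟩) | (rfl | ⟨k, rfl⟩) | (rfl | ⟨k, rfl⟩))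
  all_goals first | exact h _ _ (by omega) | norm_num
end

section
open scoped Classical
variable {V : Type*}

/-! ### Graphs with marked vertices and their Lagrangians -/

/-- The indicator of the set `A` of marked vertices, as a real number. -/
noncomputable def markInd (A : Set V) (v : V) : ℝ := if v ∈ A then 1 else 0

/-- The entries of the adjacency matrix of `Γ`, as real numbers. -/
noncomputable def adjInd (Γ : SimpleGraph V) (u v : V) : ℝ := if Γ.Adj u v then 1 else 0

/-- The Lubell function of the hypergraph induced on `S` whose `1`-edges are the elements of `A`
and whose `2`-edges are the edges of `Γ`. The double sum runs over ordered pairs. -/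
noncomputable def markedLubell (A : Set V) (Γ : SimpleGraph V) (S : Finset V) : ℝ :=
  (∑ v ∈ S, markInd A v) / S.card +
    (∑ u ∈ S, ∑ v ∈ S, adjInd Γ u v) / (S.card * (S.card - 1))

/-- The Lagrange polynomial of the graph `Γ` with set `A` of marked vertices, restricted to `S`. -/
noncomputable def lagrange (A : Set V) (Γ : SimpleGraph V) (S : Finset V) (x : V → ℝ) : ℝ :=
  ∑ v ∈ S, x v * markInd A v + ∑ u ∈ S, ∑ v ∈ S, x u * x v * adjInd Γ u v

lemma markInd_nonneg (A : Set V) (v : V) : 0 ≤ markInd A v := by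
  unfold markInd; split_ifs <;> norm_num

lemma markInd_le_one (A : Set V) (v : V) : markInd A v ≤ 1 := by
  unfold markInd; split_ifs <;> norm_num

lemma adjInd_nonneg (Γ : SimpleGraph V) (u v : V) : 0 ≤ adjInd Γ u v := by
  unfold adjInd; split_ifs <;> norm_num

lemma adjInd_le_one (Γ : SimpleGraph V) (u v : V) : adjInd Γ u v ≤ 1 := by
  unfold adjInd; split_ifs <;> norm_num

lemma adjInd_self (Γ : SimpleGraph V) (v : V) : adjInd Γ v v = 0 := by simp [adjInd]

lemma adjInd_comm (Γ : SimpleGraph V) (u v : V) : adjInd Γ u v = adjInd Γ v u := by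
  simp [adjInd, Γ.adj_comm]

lemma sum_adjInd_le (Γ : SimpleGraph V) (S : Finset V) :
    ∑ u ∈ S, ∑ v ∈ S, adjInd Γ u v ≤ S.card * (S.card - 1) := by
  have : ∀ u ∈ S, ∑ v ∈ S, adjInd Γ u v ≤ S.card - 1 := fun u hu => by
    rw [← Finset.add_sum_erase S _ hu, adjInd_self, zero_add]
    refine (Finset.sum_le_card_nsmul _ _ 1 fun v _ => adjInd_le_one Γ u v).trans ?_
    rw [Finset.card_erase_of_mem hu, nsmul_eq_mul, mul_one,
      Nat.cast_sub (Finset.card_pos.2 ⟨u, hu⟩), Nat.cast_one]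
  refine (Finset.sum_le_card_nsmul _ _ _ this).trans ?_
  rw [nsmul_eq_mul]

lemma lagrange_insert (A : Set V) (Γ : SimpleGraph V) {S : Finset V} {i : V} (hi : i ∉ S)
    (x : V → ℝ) : lagrange A Γ (insert i S) x =
      x i * (markInd A i + 2 * ∑ k ∈ S, x k * adjInd Γ i k) + lagrange A Γ S x := by
  have h1 : ∑ u ∈ S, x u * x i * adjInd Γ u i = x i * ∑ k ∈ S, x k * adjInd Γ i k := by
    rw [Finset.mul_sum]
    exact Finset.sum_congr rfl fun u _ => by rw [adjInd_comm]; ring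
  have h2 : ∑ u ∈ S, x i * x u * adjInd Γ i u = x i * ∑ k ∈ S, x k * adjInd Γ i k := by
    rw [Finset.mul_sum]
    exact Finset.sum_congr rfl fun u _ => by ring
  simp only [lagrange, Finset.sum_insert hi, adjInd_self, mul_zero, zero_add,
    Finset.sum_add_distrib, h1, h2]
  ring

lemma lagrange_congr (A : Set V) (Γ : SimpleGraph V) {S : Finset V} {x y : V → ℝ}
    (h : ∀ v ∈ S, x v = y v) : lagrange A Γ S x = lagrange A Γ S y := by
  unfold lagrange
  congr 1
  · exact Finset.sum_congr rfl fun v hv => by rw [h v hv]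
  · exact Finset.sum_congr rfl fun u hu => Finset.sum_congr rfl fun v hv => by rw [h u hu, h v hv]

/-- The Lagrange polynomial of a clique is bounded by the density of the clique. -/
lemma lagrange_le_of_isClique (A : Set V) (Γ : SimpleGraph V) (S : Finset V) (x : V → ℝ)
    (hx : ∀ v ∈ S, 0 ≤ x v) (hsum : ∑ v ∈ S, x v = 1) (hS : Γ.IsClique S) :
    lagrange A Γ S x ≤
      cliqueDensity (S.filter (· ∈ A)).card (S.filter (· ∉ A)).card := by
  have hmark : ∑ v ∈ S, x v * markInd A v = ∑ v ∈ S.filter (· ∈ A), x v := by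
    rw [Finset.sum_filter]
    exact Finset.sum_congr rfl fun v _ => by simp [markInd]
  have hadj : ∑ u ∈ S, ∑ v ∈ S, x u * x v * adjInd Γ u v = 1 - ∑ v ∈ S, x v ^ 2 := by
    have : ∀ u ∈ S, ∑ v ∈ S, x u * x v * adjInd Γ u v = x u - x u ^ 2 := fun u hu => by
      have h1 : ∀ v ∈ S, x u * x v * adjInd Γ u v = x u * x v - if u = v then x u * x v else 0 :=
        fun v hv => by
          by_cases huv : u = v
          · subst huv; simp [adjInd_self]
          · simp [adjInd, hS hu hv huv, huv]
      rw [Finset.sum_congr rfl h1, Finset.sum_sub_distrib, ← Finset.mul_sum, hsum,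
        Finset.sum_ite_eq, if_pos hu]
      ring
    rw [Finset.sum_congr rfl this, Finset.sum_sub_distrib, hsum]
  have hs := Finset.sum_filter_add_sum_filter_not S (· ∈ A) x
  have hs2 := Finset.sum_filter_add_sum_filter_not S (· ∈ A) (fun v => x v ^ 2)
  have hn : 0 ≤ ∑ v ∈ S.filter (· ∉ A), x v :=
    Finset.sum_nonneg fun v hv => hx v (Finset.mem_filter.1 hv).1
  have := le_cliqueDensity (a := (S.filter (· ∈ A)).card) (b := (S.filter (· ∉ A)).card)
    (s := ∑ v ∈ S.filter (· ∈ A), x v) (p := ∑ v ∈ S.filter (· ∈ A), x v ^ 2)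
    (q := ∑ v ∈ S.filter (· ∉ A), x v ^ 2) (by linarith)
    (Finset.sum_nonneg fun v _ => sq_nonneg _) (Finset.sum_nonneg fun v _ => sq_nonneg _)
    sq_sum_le_card_mul_sum_sq (by
      rw [show 1 - ∑ v ∈ S.filter (· ∈ A), x v = ∑ v ∈ S.filter (· ∉ A), x v by linarith]
      exact sq_sum_le_card_mul_sum_sq)
  rw [lagrange, hmark, hadj]
  linarith

/-- Moving all the weight of one of two non-adjacent vertices to the other one does not decrease
the Lagrange polynomial, provided that the right vertex is emptied. -/
lemma exists_erase_lagrange_ge (A : Set V) (Γ : SimpleGraph V) {S : Finset V} {x : V → ℝ}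
    (hx : ∀ v ∈ S, 0 ≤ x v) {i j : V} (hi : i ∈ S) (hj : j ∈ S) (hij : i ≠ j)
    (hadj : ¬ Γ.Adj i j) :
    ∃ k ∈ S, ∃ y : V → ℝ, (∀ v ∈ S.erase k, 0 ≤ y v) ∧
      ∑ v ∈ S.erase k, y v = ∑ v ∈ S, x v ∧ lagrange A Γ S x ≤ lagrange A Γ (S.erase k) y := by
  set T := (S.erase i).erase j with hT
  -- `c l` is the coefficient of the weight of `l ∈ {i, j}`; there is no cross term
  set c : V → ℝ := fun l => markInd A l + 2 * ∑ k ∈ T, x k * adjInd Γ l k with hc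
  wlog hle : c j ≤ c i generalizing i j
  · refine this hj hi hij.symm (fun h => hadj h.symm) rfl rfl ?_
    have e : (S.erase j).erase i = T := Finset.erase_right_comm
    simp only [e]
    exact (not_le.1 hle).le
  have hjT : j ∉ T := Finset.notMem_erase _ _
  have hiT : i ∉ T := fun h => Finset.notMem_erase i S (Finset.mem_of_mem_erase h)
  have hiS : i ∉ insert j T := by simp [hij, hiT]
  have hSj : S.erase j = insert i T := by
    rw [hT, Finset.erase_right_comm, Finset.insert_erase (Finset.mem_erase.2 ⟨hij, hi⟩)]
  have hS : S = insert i (insert j T) := by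
    rw [hT, Finset.insert_erase (Finset.mem_erase.2 ⟨hij.symm, hj⟩), Finset.insert_erase hi]
  set y : V → ℝ := Function.update x i (x i + x j) with hy
  have hyT : ∀ v ∈ T, y v = x v := fun v hv =>
    Function.update_of_ne (by rintro rfl; exact hiT hv) _ _
  have hyi : y i = x i + x j := Function.update_self _ _ _
  refine ⟨j, hj, y, fun v hv => ?_, ?_, ?_⟩
  · by_cases hvi : v = i
    · rw [hvi, hyi]; exact add_nonneg (hx i hi) (hx j hj)
    · rw [hy, Function.update_of_ne hvi]; exact hx v (Finset.mem_of_mem_erase hv)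
  · rw [hSj, hS, Finset.sum_insert hiT, Finset.sum_insert hiS, Finset.sum_insert hjT, hyi,
      Finset.sum_congr rfl hyT]
    ring
  · have h0 : adjInd Γ i j = 0 := by simp [adjInd, hadj]
    have hsum : ∑ k ∈ T, y k * adjInd Γ i k = ∑ k ∈ T, x k * adjInd Γ i k :=
      Finset.sum_congr rfl fun v hv => by rw [hyT v hv]
    rw [hSj, lagrange_insert A Γ hiT, hyi, lagrange_congr A Γ hyT, hsum]
    rw [hS, lagrange_insert A Γ hiS, lagrange_insert A Γ hjT, Finset.sum_insert hjT, h0]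
    have := mul_le_mul_of_nonneg_left hle (hx j hj)
    simp only [hc] at this
    linarith

/-- A Motzkin–Straus type theorem: the Lagrange polynomial at a probability vector is bounded by
the density of some clique. -/
lemma exists_isClique_lagrange_le (A : Set V) (Γ : SimpleGraph V) (S : Finset V) (x : V → ℝ)
    (hx : ∀ v ∈ S, 0 ≤ x v) (hsum : ∑ v ∈ S, x v = 1) :
    ∃ C ⊆ S, C.Nonempty ∧ Γ.IsClique C ∧
      lagrange A Γ S x ≤ cliqueDensity (C.filter (· ∈ A)).card (C.filter (· ∉ A)).card := by
  induction hn : S.card generalizing S x with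
  | zero =>
    rw [Finset.card_eq_zero] at hn
    simp [hn] at hsum
  | succ n ih =>
    by_cases hS : Γ.IsClique S
    · exact ⟨S, subset_rfl, Finset.card_pos.1 (by omega), hS,
        lagrange_le_of_isClique A Γ S x hx hsum hS⟩
    · obtain ⟨i, hi, j, hj, hij, hadj⟩ : ∃ i ∈ S, ∃ j ∈ S, i ≠ j ∧ ¬ Γ.Adj i j := by
        by_contra! h
        exact hS fun i hi j hj hij => h i hi j hj hij
      obtain ⟨k, hk, y, hy, hysum, hle⟩ := exists_erase_lagrange_ge A Γ hx hi hj hij hadj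
      obtain ⟨C, hCS, hC⟩ := ih (S.erase k) y hy (hysum.trans hsum)
        (by rw [Finset.card_erase_of_mem hk, hn]; rfl)
      exact ⟨C, hCS.trans (Finset.erase_subset _ _), hC.1, hC.2.1, hle.trans hC.2.2⟩

/-- The uniform weights give a clique whose density is nearly the Lubell function. -/
lemma exists_isClique_markedLubell_le (A : Set V) (Γ : SimpleGraph V) (S : Finset V)
    (hS : 2 ≤ S.card) : ∃ C ⊆ S, C.Nonempty ∧ Γ.IsClique C ∧
      markedLubell A Γ S ≤
        cliqueDensity (C.filter (· ∈ A)).card (C.filter (· ∉ A)).card + 1 / S.card := by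
  have hN : (2 : ℝ) ≤ S.card := by exact_mod_cast hS
  obtain ⟨C, hCS, hC0, hC, hle⟩ := exists_isClique_lagrange_le A Γ S (fun _ => 1 / (S.card : ℝ))
    (fun _ _ => by positivity)
    (by rw [Finset.sum_const, nsmul_eq_mul]; field_simp)
  refine ⟨C, hCS, hC0, hC, le_trans ?_ (add_le_add_left hle _)⟩
  set E := ∑ u ∈ S, ∑ v ∈ S, adjInd Γ u v with hE
  have hE1 : E ≤ S.card * (S.card - 1) := sum_adjInd_le Γ S
  have h1 : lagrange A Γ S (fun _ => 1 / (S.card : ℝ)) =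
      (∑ v ∈ S, markInd A v) / S.card + E / (S.card * S.card) := by
    simp only [lagrange, ← Finset.mul_sum]
    rw [← hE]
    field_simp
  rw [h1, markedLubell, ← hE]
  have h2 : E / (S.card * (S.card - 1)) = E / (S.card * S.card) +
      (E / (S.card * (S.card - 1))) * (1 / S.card) := by
    have : (S.card : ℝ) - 1 ≠ 0 := by linarith
    field_simp
    ring
  have h3 : E / (S.card * (S.card - 1)) ≤ 1 :=
    div_le_one_of_le₀ hE1 (mul_nonneg (Nat.cast_nonneg _) (by linarith only [hN]))
  have h4 : (E / (S.card * (S.card - 1))) * (1 / (S.card : ℝ)) ≤ 1 / S.card :=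
    mul_le_of_le_one_left (one_div_nonneg.2 (Nat.cast_nonneg _)) h3
  linarith

/-! ### Averaging over vertex deletions -/

lemma exists_erase_markedLubell_ge (A : Set V) (Γ : SimpleGraph V) {S : Finset V}
    (hS : 3 ≤ S.card) : ∃ v ∈ S, markedLubell A Γ S ≤ markedLubell A Γ (S.erase v) := by
  have hN : (3 : ℝ) ≤ S.card := by exact_mod_cast hS
  set M := ∑ v ∈ S, markInd A v with hM
  set E := ∑ u ∈ S, ∑ v ∈ S, adjInd Γ u v with hE
  have hterm : ∀ v ∈ S, markedLubell A Γ (S.erase v) =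
      (M - markInd A v) / (S.card - 1) +
        (E - 2 * ∑ u ∈ S, adjInd Γ v u) / ((S.card - 1) * (S.card - 2)) := fun v hv => by
    have hcard : ((S.erase v).card : ℝ) = S.card - 1 := by
      rw [Finset.card_erase_of_mem hv, Nat.cast_sub (by omega), Nat.cast_one]
    have h1 : ∑ u ∈ S.erase v, markInd A u = M - markInd A v := by
      rw [hM, ← Finset.add_sum_erase S _ hv]; ring
    have h2 : ∑ u ∈ S.erase v, ∑ w ∈ S.erase v, adjInd Γ u w =
        E - 2 * ∑ u ∈ S, adjInd Γ v u := by
      have hrow : ∀ u, ∑ w ∈ S.erase v, adjInd Γ u w = ∑ w ∈ S, adjInd Γ u w - adjInd Γ v u :=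
        fun u => by rw [← Finset.add_sum_erase S _ hv, adjInd_comm Γ u v]; ring
      have hcol : ∀ f : V → ℝ, ∑ u ∈ S.erase v, f u = ∑ u ∈ S, f u - f v :=
        fun f => by rw [← Finset.add_sum_erase S _ hv]; ring
      simp only [hrow, hcol, Finset.sum_sub_distrib, adjInd_self, ← hE]
      ring
    rw [markedLubell, hcard, h1, h2]
    ring_nf
  have hsum : ∑ v ∈ S, markedLubell A Γ (S.erase v) = S.card * markedLubell A Γ S := by
    rw [Finset.sum_congr rfl hterm, Finset.sum_add_distrib, ← Finset.sum_div, ← Finset.sum_div,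
      Finset.sum_sub_distrib, Finset.sum_sub_distrib, ← Finset.mul_sum, ← hM, ← hE,
      markedLubell, ← hM, ← hE, Finset.sum_const, Finset.sum_const, nsmul_eq_mul, nsmul_eq_mul]
    have h1 : (S.card : ℝ) - 1 ≠ 0 := by linarith
    have h2 : (S.card : ℝ) - 2 ≠ 0 := by linarith
    field_simp
  refine Finset.exists_le_of_sum_le (Finset.card_pos.1 (by omega)) ?_
  rw [hsum, Finset.sum_const, nsmul_eq_mul]

/-- Averaging: a set of vertices contains sets of every smaller size with at least the same Lubell
function. -/
lemma exists_subset_markedLubell_ge (A : Set V) (Γ : SimpleGraph V) {t : ℕ} (ht : 2 ≤ t)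
    (S : Finset V) (hS : t ≤ S.card) :
    ∃ T ⊆ S, T.card = t ∧ markedLubell A Γ S ≤ markedLubell A Γ T := by
  induction hn : S.card generalizing S with
  | zero => omega
  | succ n ih =>
    rcases hS.eq_or_lt with h | h
    · exact ⟨S, subset_rfl, h.symm, le_rfl⟩
    · obtain ⟨v, hv, hle⟩ := exists_erase_markedLubell_ge A Γ (S := S) (by omega)
      have hc := Finset.card_erase_of_mem hv
      obtain ⟨T, hTS, hT, hle'⟩ := ih (S.erase v) (by omega) (by omega)
      exact ⟨T, hTS.trans (Finset.erase_subset _ _), hT, hle.trans hle'⟩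

/-! ### Blow-ups of cliques -/

/-- The optimal integer weight of a vertex in a clique with `a` marked and `b` unmarked vertices;
`m` tells whether the vertex is marked. -/
def cliqueWeight (a b : ℕ) (m : Prop) [Decidable m] : ℕ :=
  if m then (if a = 1 then b + 2 else 1) else (if 2 ≤ a then 0 else 1)

/-- The weights `cliqueWeight` attain the value `cliqueDensity`. -/
lemma cliqueDensity_eq_cliqueWeight {a b : ℕ} (h : 1 ≤ a + b) :
    0 < a * cliqueWeight a b True + b * cliqueWeight a b False ∧
    cliqueDensity a b =
      (a * cliqueWeight a b True : ℝ) / (a * cliqueWeight a b True + b * cliqueWeight a b False) +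
      1 - (a * (cliqueWeight a b True : ℝ) ^ 2 + b * (cliqueWeight a b False : ℝ) ^ 2) /
        (a * cliqueWeight a b True + b * cliqueWeight a b False) ^ 2 := by
  match a, b, h with
  | 0, b + 1, _ =>
    simp [cliqueDensity_zero, cliqueWeight]
    field_simp
  | 1, b, _ =>
    simp [cliqueDensity_one, cliqueWeight]
    field_simp
    ring
  | a + 2, b, _ =>
    rw [cliqueDensity_of_two_le (by omega)]
    simp [cliqueWeight]
    field_simp
    ring

/-- A blow-up of a clique `C`, with part sizes proportional to the optimal weights, has Lubell
function at least the density of the clique. -/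
lemma cliqueDensity_le_markedLubell_biUnion {I : Type*} (B : Set I) (C : Finset I)
    (A : Set V) (Γ : SimpleGraph V) (P : I → Finset V) {a b q : ℕ}
    (ha : (C.filter (· ∈ B)).card = a) (hb : (C.filter (· ∉ B)).card = b) (hab : 1 ≤ a + b)
    (hcard : ∀ i ∈ C, (P i).card = cliqueWeight a b (i ∈ B) * q)
    (hmark : ∀ i ∈ C, i ∈ B → ∀ v ∈ P i, v ∈ A)
    (hadj : ∀ i ∈ C, ∀ j ∈ C, i ≠ j → ∀ u ∈ P i, ∀ v ∈ P j, Γ.Adj u v) (hq : 2 ≤ q) :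
    q ≤ (C.biUnion P).card ∧ cliqueDensity a b ≤ markedLubell A Γ (C.biUnion P) := by
  obtain ⟨hpos, hval⟩ := cliqueDensity_eq_cliqueWeight hab
  set w₁ := cliqueWeight a b True with hw₁
  set w₀ := cliqueWeight a b False with hw₀
  have hdisj : (C : Set I).PairwiseDisjoint P := fun i hi j hj hij =>
    Finset.disjoint_left.2 fun v hv hv' => Γ.irrefl (hadj i hi j hj hij v hv v hv')
  have hc1 : ∀ i ∈ C.filter (· ∈ B), (P i).card = w₁ * q := fun i hi => by
    rw [hcard i (Finset.mem_filter.1 hi).1, hw₁]; congr 1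
    simp [cliqueWeight, (Finset.mem_filter.1 hi).2]
  have hc0 : ∀ i ∈ C.filter (· ∉ B), (P i).card = w₀ * q := fun i hi => by
    rw [hcard i (Finset.mem_filter.1 hi).1, hw₀]; congr 1
    simp [cliqueWeight, (Finset.mem_filter.1 hi).2]
  -- summing a function of the part sizes over the parts
  have hsplit : ∀ f : ℕ → ℝ, ∑ i ∈ C, f (P i).card = a * f (w₁ * q) + b * f (w₀ * q) := fun f => by
    rw [← Finset.sum_filter_add_sum_filter_not C (· ∈ B),
      Finset.sum_congr rfl fun i hi => by rw [hc1 i hi],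
      Finset.sum_congr (s₁ := C.filter (· ∉ B)) rfl fun i hi => by rw [hc0 i hi],
      Finset.sum_const, Finset.sum_const, ha, hb, nsmul_eq_mul, nsmul_eq_mul]
  set S := C.biUnion P with hS
  have hScard : S.card = ∑ i ∈ C, (P i).card := Finset.card_biUnion hdisj
  have hSr : (S.card : ℝ) = (a * w₁ + b * w₀) * q := by
    rw [hScard, Nat.cast_sum, hsplit fun n => (n : ℝ)]; push_cast; ring
  have hSn : S.card = (a * w₁ + b * w₀) * q := by exact_mod_cast hSr
  have hqS : q ≤ S.card := by rw [hSn]; exact Nat.le_mul_of_pos_left _ hpos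
  refine ⟨hqS, ?_⟩
  have hM : (a * w₁ * q : ℝ) ≤ ∑ v ∈ S, markInd A v := by
    rw [hS, Finset.sum_biUnion hdisj]
    calc (a * w₁ * q : ℝ) = ∑ i ∈ C.filter (· ∈ B), ((P i).card : ℝ) := by
          rw [Finset.sum_congr rfl fun i hi => by rw [hc1 i hi], Finset.sum_const, ha,
            nsmul_eq_mul]
          push_cast; ring
      _ = ∑ i ∈ C.filter (· ∈ B), ∑ v ∈ P i, markInd A v := by
          refine Finset.sum_congr rfl fun i hi => ?_
          obtain ⟨hiC, hiB⟩ := Finset.mem_filter.1 hi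
          rw [Finset.sum_congr rfl fun v hv => by
            rw [show markInd A v = 1 by simp [markInd, hmark i hiC hiB v hv]]]
          simp
      _ ≤ _ := Finset.sum_le_sum_of_subset_of_nonneg (Finset.filter_subset _ _)
          fun i _ _ => Finset.sum_nonneg fun v _ => markInd_nonneg A v
  have hE : (S.card : ℝ) ^ 2 - (a * w₁ ^ 2 + b * w₀ ^ 2) * q ^ 2 ≤
      ∑ u ∈ S, ∑ v ∈ S, adjInd Γ u v := by
    have hrow : ∀ i ∈ C, ∀ u ∈ P i, (S.card : ℝ) - (P i).card ≤ ∑ v ∈ S, adjInd Γ u v :=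
      fun i hi u hu => by
        have hPS : P i ⊆ S := Finset.subset_biUnion_of_mem P hi
        have : ∑ v ∈ S \ P i, adjInd Γ u v = ((S \ P i).card : ℝ) := by
          rw [Finset.sum_congr rfl fun v hv => show adjInd Γ u v = 1 from ?_]
          · simp
          · obtain ⟨hvS, hvP⟩ := Finset.mem_sdiff.1 hv
            obtain ⟨j, hj, hvj⟩ := Finset.mem_biUnion.1 hvS
            have hij : i ≠ j := fun h => hvP (h ▸ hvj)
            simp [adjInd, hadj i hi j hj hij u hu v hvj]
        rw [← Nat.cast_sub (Finset.card_le_card hPS), ← Finset.card_sdiff_of_subset hPS, ← this]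
        exact Finset.sum_le_sum_of_subset_of_nonneg Finset.sdiff_subset
          fun v _ _ => adjInd_nonneg Γ u v
    calc (S.card : ℝ) ^ 2 - (a * w₁ ^ 2 + b * w₀ ^ 2) * q ^ 2
        = ∑ i ∈ C, ((P i).card : ℝ) * (S.card - (P i).card) := by
          rw [hsplit fun n => (n : ℝ) * (S.card - n), hSr]; push_cast; ring
      _ ≤ ∑ i ∈ C, ∑ u ∈ P i, ∑ v ∈ S, adjInd Γ u v := by
          refine Finset.sum_le_sum fun i hi => ?_
          have := Finset.card_nsmul_le_sum _ _ _ (hrow i hi)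
          rwa [nsmul_eq_mul] at this
      _ = _ := by rw [hS, Finset.sum_biUnion hdisj]
  have hN : (2 : ℝ) ≤ S.card := by exact_mod_cast hq.trans hqS
  have hE0 : 0 ≤ ∑ u ∈ S, ∑ v ∈ S, adjInd Γ u v :=
    Finset.sum_nonneg fun u _ => Finset.sum_nonneg fun v _ => adjInd_nonneg Γ u v
  have hq0 : (q : ℝ) ≠ 0 := by positivity
  have hW : (0 : ℝ) < a * w₁ + b * w₀ := by exact_mod_cast hpos
  calc cliqueDensity a b
      = (a * w₁ * q) / S.card +
          ((S.card : ℝ) ^ 2 - (a * w₁ ^ 2 + b * w₀ ^ 2) * q ^ 2) / (S.card * S.card) := by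
        rw [hval, hSr]; field_simp; ring
    _ ≤ (∑ v ∈ S, markInd A v) / S.card +
          (∑ u ∈ S, ∑ v ∈ S, adjInd Γ u v) / (S.card * S.card) := by gcongr
    _ ≤ markedLubell A Γ S := by
        rw [markedLubell]
        refine add_le_add le_rfl
          (div_le_div_of_nonneg_left hE0 (mul_pos (by linarith) (by linarith)) ?_)
        gcongr
        linarith
end

section
open scoped Classical

/-! ### Complete multipartite subsystems of dense systems of tuples -/

/-- Erdős's theorem on complete `m`-partite `m`-uniform hypergraphs, for ordered tuples: a set of
`m`-tuples of positive density contains a box all of whose sides have size `s`. -/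
theorem exists_box_of_density (m s : ℕ) {δ : ℝ} (hδ : 0 < δ) :
    ∃ n₀ : ℕ, ∀ (W : Type) [Fintype W], n₀ ≤ Fintype.card W → ∀ S : Finset (Fin m → W),
      δ * (Fintype.card W : ℝ) ^ m ≤ S.card →
        ∃ P : Fin m → Finset W, (∀ i, (P i).card = s) ∧ ∀ f, (∀ i, f i ∈ P i) → f ∈ S := by
  induction m generalizing δ with
  | zero =>
    refine ⟨0, fun W _ _ S hS => ⟨Fin.elim0, fun i => i.elim0, fun f _ => ?_⟩⟩
    have : (0 : ℝ) < S.card := by simp at hS; linarith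
    obtain ⟨g, hg⟩ := Finset.card_pos.1 (by exact_mod_cast this)
    rwa [Subsingleton.elim f g]
  | succ m ih =>
    -- a set of at least `δ / 2 * n` elements has at least `c * n ^ s` subsets of size `s`
    set c : ℝ := (δ / 4) ^ s / s.factorial with hc
    have hc0 : 0 < c := by positivity
    obtain ⟨n₁, hn₁⟩ := ih (δ := c * (δ / 2)) (by positivity)
    obtain ⟨n₂, hn₂⟩ := exists_nat_ge (4 * s / δ)
    refine ⟨max n₁ (max n₂ (s + 1)), fun W _ hn S hS => ?_⟩
    set n := Fintype.card W with hn_def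
    have hn1 : n₁ ≤ n := (le_max_left _ _).trans hn
    have hn2 : n₂ ≤ n := (le_max_left _ _).trans ((le_max_right _ _).trans hn)
    have hns : s + 1 ≤ n := (le_max_right _ _).trans ((le_max_right _ _).trans hn)
    have hnpos : (0 : ℝ) < n := by exact_mod_cast (by omega : 0 < n)
    have hsn : (s : ℝ) ≤ δ / 4 * n := by
      have : 4 * s / δ ≤ n := hn₂.trans (by exact_mod_cast hn2)
      rw [div_le_iff₀ hδ] at this
      linarith
    -- the first coordinates that extend a given `m`-tuple to an element of `S`
    let N : (Fin m → W) → Finset W := fun y => Finset.univ.filter fun v => Fin.cons v y ∈ S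
    have hN : ∀ y v, v ∈ N y ↔ Fin.cons v y ∈ S := fun y v => by simp [N]
    have hNn : ∀ y, (N y).card ≤ n := fun y => Finset.card_le_univ _
    have hSsum : (S.card : ℝ) = ∑ y : Fin m → W, ((N y).card : ℝ) := by
      rw [Finset.card_eq_sum_card_fiberwise (f := Fin.tail) (t := Finset.univ)
        (fun _ _ => Finset.mem_coe.2 (Finset.mem_univ _))]
      push_cast
      refine Finset.sum_congr rfl fun y _ => ?_
      congr 1
      refine Finset.card_nbij' (fun f => f 0) (fun v => Fin.cons v y) ?_ ?_ ?_ ?_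
      · intro f hf
        obtain ⟨hf, rfl⟩ := Finset.mem_filter.1 hf
        exact (hN _ _).2 (by rwa [Fin.cons_self_tail])
      · intro v hv
        exact Finset.mem_filter.2 ⟨(hN _ _).1 hv, Fin.tail_cons _ _⟩
      · intro f hf
        obtain ⟨hf, rfl⟩ := Finset.mem_filter.1 hf
        exact Fin.cons_self_tail f
      · intro v _
        exact Fin.cons_zero _ _
    set Y : Finset (Fin m → W) := Finset.univ.filter fun y => δ / 2 * n ≤ (N y).card with hY
    have hYcard : δ / 2 * (n : ℝ) ^ m ≤ Y.card := by
      have h1 : ∀ y : Fin m → W, ((N y).card : ℝ) ≤ (if y ∈ Y then (n : ℝ) else 0) + δ / 2 * n :=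
        fun y => by
          by_cases hy : y ∈ Y
          · rw [if_pos hy]
            have : ((N y).card : ℝ) ≤ n := by exact_mod_cast hNn y
            have : 0 ≤ δ / 2 * n := by positivity
            linarith
          · rw [if_neg hy, zero_add]
            simp only [hY, Finset.mem_filter, Finset.mem_univ, true_and, not_le] at hy
            exact hy.le
      have h2 := Finset.sum_le_sum fun y (_ : y ∈ Finset.univ) => h1 y
      rw [← hSsum, Finset.sum_add_distrib, Finset.sum_ite_mem, Finset.univ_inter,
        Finset.sum_const, Finset.sum_const, Finset.card_univ, Fintype.card_fun, Fintype.card_fin,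
        nsmul_eq_mul, nsmul_eq_mul, ← hn_def] at h2
      have h3 := hS.trans h2
      push_cast at h3
      rw [pow_succ] at h3
      refine le_of_mul_le_mul_right ?_ hnpos
      linarith
    have hchoose : ∀ y ∈ Y, c * (n : ℝ) ^ s ≤ ((N y).powersetCard s).card := fun y hy => by
      have hy' : δ / 2 * n ≤ (N y).card := (Finset.mem_filter.1 hy).2
      have hsd : s ≤ (N y).card := by
        have : (s : ℝ) ≤ (N y).card := by nlinarith
        exact_mod_cast this
      have h1 := Nat.pow_le_choose (α := ℝ) s (N y).card
      rw [Finset.card_powersetCard, hc, div_mul_eq_mul_div, ← mul_pow]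
      refine le_trans ?_ h1
      gcongr
      rw [Nat.cast_sub (by omega)]
      push_cast
      linarith
    have hdouble : ∑ B ∈ Finset.univ.powersetCard s, ((Y.filter fun y => B ⊆ N y).card : ℝ) =
        ∑ y ∈ Y, (((N y).powersetCard s).card : ℝ) := by
      have := Finset.sum_card_bipartiteAbove_eq_sum_card_bipartiteBelow
        (s := (Finset.univ : Finset W).powersetCard s) (t := Y) (fun B y => B ⊆ N y)
      rw [← Nat.cast_sum, ← Nat.cast_sum]
      congr 1
      refine this.trans (Finset.sum_congr rfl fun y _ => congrArg Finset.card ?_)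
      ext B
      simp [Finset.bipartiteBelow, Finset.mem_powersetCard, and_comm]
    -- some `s`-set `B` consists of common extensions of a positive proportion of the tuples in `Y`
    obtain ⟨B, hB, hBc⟩ : ∃ B ∈ (Finset.univ : Finset W).powersetCard s,
        c * Y.card ≤ ((Y.filter fun y => B ⊆ N y).card : ℝ) := by
      refine Finset.exists_le_of_sum_le ?_ ?_
      · exact Finset.powersetCard_nonempty.2 (by rw [Finset.card_univ]; omega)
      · rw [hdouble, Finset.sum_const, nsmul_eq_mul, Finset.card_powersetCard, Finset.card_univ,
          ← hn_def]
        have h1 : ((n.choose s : ℕ) : ℝ) ≤ (n : ℝ) ^ s := by exact_mod_cast Nat.choose_le_pow n s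
        have h2 := Finset.card_nsmul_le_sum _ _ _ hchoose
        rw [nsmul_eq_mul] at h2
        refine le_trans ?_ h2
        calc (n.choose s : ℝ) * (c * Y.card) ≤ (n : ℝ) ^ s * (c * Y.card) := by gcongr
          _ = _ := by ring
    obtain ⟨P, hP, hPS⟩ := hn₁ W hn1 (Y.filter fun y => B ⊆ N y) (by
      refine le_trans ?_ hBc
      rw [mul_assoc]
      gcongr)
    refine ⟨Fin.cons B P, fun i => ?_, fun f hf => ?_⟩
    · refine Fin.cases ?_ (fun i => ?_) i
      · rw [Fin.cons_zero]; exact (Finset.mem_powersetCard.1 hB).2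
      · rw [Fin.cons_succ]; exact hP i
    · have htail : Fin.tail f ∈ Y.filter fun y => B ⊆ N y :=
        hPS _ fun i => by simpa [Fin.tail] using hf i.succ
      have h0 : f 0 ∈ B := by simpa using hf 0
      have := (hN _ _).1 ((Finset.mem_filter.1 htail).2 h0)
      rwa [Fin.cons_self_tail] at this

/-! ### Sampling vertices with repetition -/

lemma card_mul_sum_comp_eval {ι W : Type*} [Fintype ι] [DecidableEq ι] [Fintype W] (g : W → ℝ) (i : ι) :
    (Fintype.card W : ℝ) * ∑ f : ι → W, g (f i) =
      (Fintype.card W : ℝ) ^ Fintype.card ι * ∑ v, g v := by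
  have h := Fintype.sum_piFinset_apply g Finset.univ i
  rw [Fintype.piFinset_univ, Finset.card_univ, nsmul_eq_mul, Nat.cast_pow] at h
  have hι : Fintype.card ι = Fintype.card ι - 1 + 1 :=
    (Nat.sub_add_cancel (Fintype.card_pos_iff.2 ⟨i⟩)).symm
  rw [h, hι, pow_succ]
  simp only [Nat.add_sub_cancel]
  ring

lemma card_sq_mul_sum_comp_eval_eval {ι W : Type*} [Fintype ι] [DecidableEq ι] [Fintype W] (h : W → W → ℝ)
    {i j : ι} (hij : j ≠ i) : (Fintype.card W : ℝ) ^ 2 * ∑ f : ι → W, h (f i) (f j) =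
      (Fintype.card W : ℝ) ^ Fintype.card ι * ∑ u, ∑ v, h u v := by
  have h1 : ∑ f : ι → W, h (f i) (f j) =
      ∑ u : W, ∑ g : {k // k ≠ i} → W, h u (g ⟨j, hij⟩) := by
    rw [← Fintype.sum_prod_type']
    exact Fintype.sum_equiv (Equiv.funSplitAt i W) _ _ fun f => by simp [Equiv.funSplitAt]
  have hι : Fintype.card ι = Fintype.card {k // k ≠ i} + 1 := by
    rw [Fintype.card_subtype_compl, Fintype.card_subtype_eq]
    exact (Nat.sub_add_cancel (Fintype.card_pos_iff.2 ⟨i⟩)).symm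
  rw [h1, hι, sq, pow_succ, mul_assoc, Finset.mul_sum]
  rw [Finset.sum_congr rfl fun u _ => card_mul_sum_comp_eval (h u) (⟨j, hij⟩ : {k // k ≠ i}),
    ← Finset.mul_sum]
  ring

/-- The Lagrange polynomial at uniform weights of the pattern induced by the tuple `f`. -/
noncomputable def sampleDensity {W : Type*} (A : Set W) (Γ : SimpleGraph W) {m : ℕ}
    (f : Fin m → W) : ℝ :=
  lagrange (f ⁻¹' A) (Γ.comap f) Finset.univ fun _ => 1 / (m : ℝ)

lemma sampleDensity_eq {W : Type*} (A : Set W) (Γ : SimpleGraph W) {m : ℕ} (f : Fin m → W) :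
    sampleDensity A Γ f = 1 / m * ∑ i, markInd A (f i) +
      1 / m * (1 / m) * ∑ i, ∑ j, adjInd Γ (f i) (f j) := by
  simp only [sampleDensity, lagrange, Finset.mul_sum]
  rfl

lemma sampleDensity_le_two {W : Type*} (A : Set W) (Γ : SimpleGraph W) {m : ℕ} (hm : 0 < m)
    (f : Fin m → W) : sampleDensity A Γ f ≤ 2 := by
  have hm' : (0 : ℝ) < m := by exact_mod_cast hm
  have h1 : ∑ i, markInd A (f i) ≤ m := by
    refine (Finset.sum_le_card_nsmul _ _ 1 fun i _ => markInd_le_one A (f i)).trans ?_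
    simp
  have h2 : ∑ i, ∑ j, adjInd Γ (f i) (f j) ≤ m * m := by
    refine (Finset.sum_le_card_nsmul _ _ (m : ℝ) fun i _ =>
      (Finset.sum_le_card_nsmul _ _ 1 fun j _ => adjInd_le_one Γ (f i) (f j)).trans ?_).trans ?_
    all_goals simp
  rw [sampleDensity_eq]
  calc _ ≤ 1 / (m : ℝ) * m + 1 / m * (1 / m) * (m * m) := by gcongr
    _ = 2 := by field_simp; norm_num

/-- The mean of `sampleDensity` is nearly the Lubell function. -/
lemma le_sum_sampleDensity {W : Type*} [Fintype W] (A : Set W) (Γ : SimpleGraph W) {m : ℕ}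
    (hm : 0 < m) (hW : 2 ≤ Fintype.card W) :
    (Fintype.card W : ℝ) ^ m *
        (markedLubell A Γ Finset.univ - 1 / Fintype.card W - 1 / m) ≤
      ∑ f : Fin m → W, sampleDensity A Γ f := by
  have hm' : (0 : ℝ) < m := by exact_mod_cast hm
  set n := Fintype.card W with hn_def
  have hn : (2 : ℝ) ≤ n := by exact_mod_cast hW
  have hn0 : (n : ℝ) ≠ 0 := by positivity
  set M := ∑ v, markInd A v
  set E := ∑ u, ∑ v, adjInd Γ u v with hE
  have hE0 : 0 ≤ E := Finset.sum_nonneg fun u _ => Finset.sum_nonneg fun v _ => adjInd_nonneg Γ u v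
  have hE1 : E ≤ n * (n - 1) := sum_adjInd_le Γ Finset.univ
  have hmark : ∀ i : Fin m, ∑ f : Fin m → W, markInd A (f i) = (n : ℝ) ^ m * (M / n) := fun i => by
    have := card_mul_sum_comp_eval (markInd A) i
    rw [Fintype.card_fin, ← hn_def] at this
    rw [mul_comm] at this
    rw [← mul_div_assoc, eq_div_iff hn0]
    exact this
  have hadj : ∀ i j : Fin m, ∑ f : Fin m → W, adjInd Γ (f i) (f j) =
      if j = i then 0 else (n : ℝ) ^ m * (E / n ^ 2) := fun i j => by
    split_ifs with h
    · subst h; simp [adjInd_self]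
    · have := card_sq_mul_sum_comp_eval_eval (adjInd Γ) h
      rw [Fintype.card_fin, ← hn_def] at this
      rw [mul_comm] at this
      rw [← mul_div_assoc, eq_div_iff (pow_ne_zero 2 hn0)]
      exact this
  have hrow : ∀ i : Fin m, ∑ j, ∑ f : Fin m → W, adjInd Γ (f i) (f j) =
      (m - 1) * ((n : ℝ) ^ m * (E / n ^ 2)) := fun i => by
    simp only [hadj]
    rw [← Finset.add_sum_erase _ _ (Finset.mem_univ i), if_pos rfl,
      Finset.sum_congr rfl fun j hj => if_neg (Finset.ne_of_mem_erase hj), Finset.sum_const,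
      Finset.card_erase_of_mem (Finset.mem_univ i), Finset.card_univ, Fintype.card_fin,
      nsmul_eq_mul, Nat.cast_sub hm, Nat.cast_one, zero_add]
  have hsum : ∑ f : Fin m → W, sampleDensity A Γ f =
      (n : ℝ) ^ m * (M / n + (1 - 1 / m) * (E / n ^ 2)) := by
    simp only [sampleDensity_eq, Finset.sum_add_distrib, ← Finset.mul_sum]
    rw [Finset.sum_comm, Finset.sum_comm (γ := Fin m → W)]
    rw [Finset.sum_congr rfl fun i _ => Finset.sum_comm]
    simp only [hmark, hrow, Finset.sum_const, Finset.card_univ, Fintype.card_fin, nsmul_eq_mul]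
    field_simp
  rw [hsum, markedLubell, Finset.card_univ, ← hn_def]
  gcongr
  set p := E / (n * (n - 1)) with hp
  have hn1 : (n : ℝ) - 1 ≠ 0 := by linarith
  have hp0 : 0 ≤ p := div_nonneg hE0 (mul_nonneg (by linarith) (by linarith))
  have hp1 : p ≤ 1 := div_le_one_of_le₀ hE1 (mul_nonneg (by linarith) (by linarith))
  have hpE : E / (n : ℝ) ^ 2 = p * (1 - 1 / n) := by rw [hp]; field_simp
  rw [hpE]
  have ha : 0 ≤ 1 / (n : ℝ) := by positivity
  have hb : 0 ≤ 1 / (m : ℝ) := by positivity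
  nlinarith [mul_nonneg (sub_nonneg.2 hp1) ha, mul_nonneg (sub_nonneg.2 hp1) hb,
    mul_nonneg (mul_nonneg hp0 ha) hb]

/-! ### Dense graphs contain blow-ups of dense cliques -/

/-- If no clique density lies in `(γ, β)`, then every large graph with marked vertices whose Lubell
function exceeds `γ` by a fixed amount contains a `t`-set whose Lubell function is at least `β`. -/
theorem exists_finset_markedLubell_ge {γ β ε : ℝ} (hε : 0 < ε)
    (hgap : ∀ a b : ℕ, 1 ≤ a + b → γ < cliqueDensity a b → β ≤ cliqueDensity a b)
    {t : ℕ} (ht : 2 ≤ t) :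
    ∃ n₀ : ℕ, ∀ (W : Type) [Fintype W], n₀ ≤ Fintype.card W → ∀ (A : Set W) (Γ : SimpleGraph W),
      γ + ε ≤ markedLubell A Γ Finset.univ →
        ∃ T : Finset W, T.card = t ∧ β ≤ markedLubell A Γ T := by
  obtain ⟨m, hm⟩ := exists_nat_gt (8 / ε)
  have hm0 : (0 : ℝ) < m := lt_trans (by positivity) hm
  have hmε : 1 / (m : ℝ) ≤ ε / 8 := by
    rw [div_lt_iff₀ hε] at hm
    rw [div_le_iff₀ hm0]; linarith
  have hmn : 0 < m := by exact_mod_cast hm0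
  have : Fintype (Set (Fin m) × SimpleGraph (Fin m)) := Fintype.ofFinite _
  set K := Fintype.card (Set (Fin m) × SimpleGraph (Fin m)) with hK
  have hK0 : (0 : ℝ) < K := by exact_mod_cast Fintype.card_pos_iff.2 ⟨(∅, ⊥)⟩
  have hM : (0 : ℝ) < 2 + |γ| := by positivity
  -- boxes of side `(m + 2) * t` have room for `t` times every clique weight, as `b + 2 ≤ m + 2`
  obtain ⟨n₁, hn₁⟩ := exists_box_of_density m ((m + 2) * t)
    (δ := ε / (4 * (2 + |γ|)) / K) (by positivity)
  refine ⟨max n₁ (max m 2), fun W _ hn A Γ hΓ => ?_⟩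
  have hn1 : n₁ ≤ Fintype.card W := (le_max_left _ _).trans hn
  have hnm : m ≤ Fintype.card W := (le_max_left _ _).trans ((le_max_right _ _).trans hn)
  have hn2 : 2 ≤ Fintype.card W := (le_max_right _ _).trans ((le_max_right _ _).trans hn)
  -- a positive proportion of the `m`-tuples sees a density exceeding `γ`
  set good : Finset (Fin m → W) :=
    Finset.univ.filter fun f => γ + ε / 2 ≤ sampleDensity A Γ f with hgood
  have hgoodcard : ε / (4 * (2 + |γ|)) * (Fintype.card W : ℝ) ^ m ≤ good.card := by
    have hnε : 1 / (Fintype.card W : ℝ) ≤ ε / 8 :=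
      (one_div_le_one_div_of_le hm0 (by exact_mod_cast hnm)).trans hmε
    have h1 : ∀ f : Fin m → W, sampleDensity A Γ f ≤
        (γ + ε / 2) + if f ∈ good then 2 + |γ| else 0 := fun f => by
      by_cases hf : f ∈ good
      · rw [if_pos hf]
        linarith [sampleDensity_le_two A Γ hmn f, neg_abs_le γ]
      · rw [if_neg hf]
        simp only [hgood, Finset.mem_filter, Finset.mem_univ, true_and, not_le] at hf
        linarith
    have h2 := (le_sum_sampleDensity A Γ hmn hn2).trans
      (Finset.sum_le_sum fun f (_ : f ∈ Finset.univ) => h1 f)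
    rw [Finset.sum_add_distrib, Finset.sum_ite_mem, Finset.univ_inter, Finset.sum_const,
      Finset.sum_const, Finset.card_univ, Fintype.card_fun, Fintype.card_fin, nsmul_eq_mul,
      nsmul_eq_mul, Nat.cast_pow] at h2
    have h3 : (Fintype.card W : ℝ) ^ m * (γ + ε * (3 / 4)) ≤ (Fintype.card W : ℝ) ^ m *
        (markedLubell A Γ Finset.univ - 1 / Fintype.card W - 1 / m) := by
      gcongr
      linarith
    rw [div_mul_eq_mul_div, div_le_iff₀ (by positivity)]
    linarith
  -- by pigeonhole, many of these tuples induce the same pattern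
  obtain ⟨D, -, hD⟩ := Finset.exists_le_card_fiber_of_nsmul_le_card_of_maps_to
    (s := good) (t := (Finset.univ : Finset (Set (Fin m) × SimpleGraph (Fin m))))
    (f := fun f => (f ⁻¹' A, Γ.comap f))
    (b := ε / (4 * (2 + |γ|)) / K * (Fintype.card W : ℝ) ^ m)
    (fun _ _ => Finset.mem_univ _) ⟨(∅, ⊥), Finset.mem_univ _⟩ (by
      rw [Finset.card_univ, ← hK, nsmul_eq_mul]
      refine le_trans (le_of_eq ?_) hgoodcard
      field_simp)
  obtain ⟨P, hP, hPD⟩ := hn₁ W hn1 _ hD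
  have hPne : ∀ i, (P i).Nonempty := fun i => Finset.card_pos.1 (by rw [hP]; positivity)
  choose g hg using hPne
  have hpat : ∀ f : Fin m → W, (∀ i, f i ∈ P i) → f ⁻¹' A = D.1 ∧ Γ.comap f = D.2 := fun f hf =>
    Prod.ext_iff.1 (Finset.mem_filter.1 (hPD f hf)).2
  have hgγ : γ + ε / 2 ≤ lagrange D.1 D.2 Finset.univ fun _ => 1 / (m : ℝ) := by
    have h := (Finset.mem_filter.1 (Finset.mem_filter.1 (hPD g hg)).1).2
    rwa [sampleDensity, (hpat g hg).1, (hpat g hg).2] at h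
  obtain ⟨C, -, hC0, hC, hle⟩ := exists_isClique_lagrange_le D.1 D.2 Finset.univ
    (fun _ => 1 / (m : ℝ)) (fun _ _ => by positivity) (by simp; field_simp)
  set a := (C.filter (· ∈ D.1)).card with ha
  set b := (C.filter (· ∉ D.1)).card with hb
  have habC : a + b = C.card := Finset.card_filter_add_card_filter_not _
  have hab : 1 ≤ a + b := by rw [habC]; exact Finset.card_pos.2 hC0
  have habm : a + b ≤ m := by rw [habC]; simpa using Finset.card_le_univ C
  have hw : ∀ i, cliqueWeight a b (i ∈ D.1) * t ≤ (P i).card := fun i => by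
    rw [hP]
    gcongr
    unfold cliqueWeight
    split_ifs <;> omega
  choose Q hQP hQ using fun i => Finset.exists_subset_card_eq (hw i)
  obtain ⟨hcard, hval⟩ := cliqueDensity_le_markedLubell_biUnion D.1 C A Γ Q ha.symm hb.symm hab
    (fun i _ => hQ i)
    (fun i _ hi v hv => by
      have h := (hpat (Function.update g i v) fun k => by
        by_cases hk : k = i
        · subst hk; rw [Function.update_self]; exact hQP _ hv
        · rw [Function.update_of_ne hk]; exact hg k).1
      rw [← h] at hi
      simpa using hi)
    (fun i hi j hj hij u hu v hv => by
      have h := (hpat (Function.update (Function.update g i u) j v) fun k => by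
        by_cases hk : k = j
        · subst hk; rw [Function.update_self]; exact hQP _ hv
        · rw [Function.update_of_ne hk]
          by_cases hk' : k = i
          · subst hk'; rw [Function.update_self]; exact hQP _ hu
          · rw [Function.update_of_ne hk']; exact hg k).2
      have hadj : D.2.Adj i j := hC hi hj hij
      rw [← h] at hadj
      simpa [hij] using hadj) ht
  obtain ⟨T, -, hT, hTle⟩ := exists_subset_markedLubell_ge A Γ ht _ hcard
  exact ⟨T, hT, (hgap a b hab (by linarith)).trans (hval.trans hTle)⟩
end

section
open scoped Classical
variable {V : Type*}

/-! ### Hypergraphs with edges of sizes one and two -/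

lemma markedLubell_map {W : Type*} (A : Set V) (Γ : SimpleGraph V) (f : W ↪ V) (T : Finset W) :
    markedLubell (f ⁻¹' A) (Γ.comap f) T = markedLubell A Γ (T.map f) := by
  simp only [markedLubell, Finset.sum_map, Finset.card_map]
  rfl

lemma markedLubell_mono {A B : Set V} {Γ Δ : SimpleGraph V} {S : Finset V}
    (hAB : ∀ v ∈ S, v ∈ A → v ∈ B) (hΓΔ : ∀ u ∈ S, ∀ v ∈ S, Γ.Adj u v → Δ.Adj u v) :
    markedLubell A Γ S ≤ markedLubell B Δ S := by
  rcases S.eq_empty_or_nonempty with rfl | hS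
  · simp [markedLubell]
  have h1 : (1 : ℝ) ≤ S.card := by exact_mod_cast Finset.card_pos.2 hS
  unfold markedLubell
  refine add_le_add (div_le_div_of_nonneg_right (Finset.sum_le_sum fun v hv => ?_)
    (Nat.cast_nonneg _)) (div_le_div_of_nonneg_right (Finset.sum_le_sum fun u hu =>
      Finset.sum_le_sum fun v hv => ?_) (mul_nonneg (Nat.cast_nonneg _) (by linarith)))
  · by_cases h : v ∈ A
    · simp [markInd, h, hAB v hv h]
    · simp only [markInd, h, if_false]; split_ifs <;> norm_num
  · by_cases h : Γ.Adj u v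
    · simp [adjInd, h, hΓΔ u hu v hv h]
    · simp only [adjInd, h, if_false]; split_ifs <;> norm_num

namespace FinHypergraph

/-- The vertices that form an edge of size one. -/
def marked (G : FinHypergraph V) : Set V := {v | {v} ∈ G.edges}

/-- The graph formed by the edges of size two. -/
def graph (G : FinHypergraph V) : SimpleGraph V where
  Adj u v := u ≠ v ∧ {u, v} ∈ G.edges
  symm := ⟨fun u v h => ⟨h.1.symm, by rw [Finset.pair_comm]; exact h.2⟩⟩
  loopless := ⟨fun _ h => h.1 rfl⟩

/-- The subgraph of `G` induced on `S`. -/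
noncomputable def induce (G : FinHypergraph V) (S : Finset V) : FinHypergraph V where
  verts := S
  edges := G.edges.filter (· ⊆ S)
  edge_subset _ he := (Finset.mem_filter.1 he).2

/-- The hypergraph on `S` whose edges of size one are given by `A` and whose edges of size two
are given by `Γ`. -/
noncomputable def ofMarked (A : Set V) (Γ : SimpleGraph V) (S : Finset V) : FinHypergraph V where
  verts := S
  edges := S.powerset.filter fun e => (∃ v ∈ A, e = {v}) ∨ ∃ u v, Γ.Adj u v ∧ e = {u, v}
  edge_subset _ he := Finset.mem_powerset.1 (Finset.mem_filter.1 he).1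

/-- The Lubell function of a `{1, 2}`-graph in terms of its marked vertices and its graph. -/
lemma lubell_eq_markedLubell {G : FinHypergraph V} (hG : G.IsRGraph {1, 2}) :
    G.lubell = markedLubell G.marked G.graph G.verts := by
  have hcard : ∀ e ∈ G.edges, e.card = 1 ∨ e.card = 2 := fun e he => by
    simpa using hG e he
  have hM : ∑ v ∈ G.verts, markInd G.marked v =
      ((G.edges.filter fun e => e.card = 1).card : ℝ) := by
    have : (G.edges.filter fun e => e.card = 1) =
        (G.verts.filter (· ∈ G.marked)).map ⟨singleton, Finset.singleton_injective⟩ := by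
      ext e
      simp only [Finset.mem_filter, Finset.mem_map, Function.Embedding.coeFn_mk, Finset.card_eq_one]
      constructor
      · rintro ⟨he, v, rfl⟩
        exact ⟨v, ⟨Finset.singleton_subset_iff.1 (G.edge_subset _ he), he⟩, rfl⟩
      · rintro ⟨v, ⟨-, hv⟩, rfl⟩
        exact ⟨hv, v, rfl⟩
    rw [this, Finset.card_map, Finset.card_filter]
    push_cast
    rfl
  have hE : ∑ u ∈ G.verts, ∑ v ∈ G.verts, adjInd G.graph u v =
      2 * ((G.edges.filter fun e => ¬ e.card = 1).card : ℝ) := by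
    have hmaps : Set.MapsTo (fun p : V × V => ({p.1, p.2} : Finset V))
        ((G.verts ×ˢ G.verts).filter fun p => G.graph.Adj p.1 p.2)
        (G.edges.filter fun e => ¬ e.card = 1) := by
      rintro ⟨u, v⟩ hp
      obtain ⟨-, huv, he⟩ := Finset.mem_filter.1 (Finset.mem_coe.1 hp)
      refine Finset.mem_coe.2 (Finset.mem_filter.2 ⟨he, ?_⟩)
      rw [Finset.card_pair huv]
      norm_num
    have hfib : ∀ e ∈ G.edges.filter fun e => ¬ e.card = 1,
        (((G.verts ×ˢ G.verts).filter fun p => G.graph.Adj p.1 p.2).filter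
          fun p => ({p.1, p.2} : Finset V) = e).card = 2 := fun e he => by
      obtain ⟨he, he1⟩ := Finset.mem_filter.1 he
      have he2 : e.card = 2 := (hcard e he).resolve_left he1
      obtain ⟨x, y, hxy, rfl⟩ := Finset.card_eq_two.1 he2
      have hsub := G.edge_subset _ he
      have hx : x ∈ G.verts := hsub (by simp)
      have hy : y ∈ G.verts := hsub (by simp)
      have : ((G.verts ×ˢ G.verts).filter fun p => G.graph.Adj p.1 p.2).filter
          (fun p => ({p.1, p.2} : Finset V) = {x, y}) = {(x, y), (y, x)} := by
        ext ⟨u, v⟩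
        simp only [Finset.mem_filter, Finset.mem_product, Finset.mem_insert,
          Finset.mem_singleton, Prod.mk.injEq]
        constructor
        · rintro ⟨⟨-, huv, -⟩, h⟩
          have hu : u ∈ ({x, y} : Finset V) := by rw [← h]; simp
          have hv : v ∈ ({x, y} : Finset V) := by rw [← h]; simp
          simp only [Finset.mem_insert, Finset.mem_singleton] at hu hv
          rcases hu with rfl | rfl <;> rcases hv with rfl | rfl <;> simp_all
        · rintro (⟨rfl, rfl⟩ | ⟨rfl, rfl⟩)
          · exact ⟨⟨⟨hx, hy⟩, hxy, he⟩, rfl⟩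
          · exact ⟨⟨⟨hy, hx⟩, hxy.symm, by rwa [Finset.pair_comm]⟩, Finset.pair_comm _ _⟩
      rw [this, Finset.card_pair]
      simp [hxy]
    have h := Finset.card_eq_sum_card_fiberwise hmaps
    rw [Finset.sum_congr rfl hfib, Finset.sum_const, smul_eq_mul, mul_comm] at h
    rw [← Finset.sum_product', ← Nat.cast_ofNat, ← Nat.cast_mul, ← h, Finset.card_filter]
    push_cast
    rfl
  rw [lubell, ← Finset.sum_filter_add_sum_filter_not G.edges (fun e => e.card = 1), markedLubell,
    hM, hE]
  congr 1
  · rw [Finset.sum_congr rfl fun e he => by rw [(Finset.mem_filter.1 he).2, Nat.choose_one_right],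
      Finset.sum_const, nsmul_eq_mul, mul_one_div]
  · rw [Finset.sum_congr rfl fun e he => by
      rw [(hcard e (Finset.mem_filter.1 he).1).resolve_left (Finset.mem_filter.1 he).2,
        Nat.cast_choose_two], Finset.sum_const, nsmul_eq_mul, one_div_div]
    ring

lemma IsRGraph.of_isSubgraph {R : Finset ℕ} {G H : FinHypergraph V} (hG : G.IsRGraph R)
    (h : H.IsSubgraph G) : H.IsRGraph R := fun e he => hG e (h.2 he)

lemma induce_isSubgraph (G : FinHypergraph V) {S : Finset V} (hS : S ⊆ G.verts) :
    (G.induce S).IsSubgraph G := ⟨hS, Finset.filter_subset _ _⟩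

lemma markedLubell_le_lubell_induce {G : FinHypergraph V} (hG : G.IsRGraph {1, 2})
    {S : Finset V} (hS : S ⊆ G.verts) :
    markedLubell G.marked G.graph S ≤ (G.induce S).lubell := by
  rw [lubell_eq_markedLubell (hG.of_isSubgraph (G.induce_isSubgraph hS))]
  refine markedLubell_mono (fun v hv h => ?_) (fun u hu v hv h => ⟨h.1, ?_⟩)
  · exact Finset.mem_filter.2 ⟨h, Finset.singleton_subset_iff.2 hv⟩
  · exact Finset.mem_filter.2 ⟨h.2, Finset.insert_subset hu (Finset.singleton_subset_iff.2 hv)⟩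

lemma ofMarked_isRGraph (A : Set V) (Γ : SimpleGraph V) (S : Finset V) :
    (ofMarked A Γ S).IsRGraph {1, 2} := fun e he => by
  rcases (Finset.mem_filter.1 he).2 with ⟨v, -, rfl⟩ | ⟨u, v, h, rfl⟩
  · simp
  · simp [Finset.card_pair h.ne]

lemma markedLubell_le_lubell_ofMarked (A : Set V) (Γ : SimpleGraph V) (S : Finset V) :
    markedLubell A Γ S ≤ (ofMarked A Γ S).lubell := by
  rw [lubell_eq_markedLubell (ofMarked_isRGraph A Γ S)]
  refine markedLubell_mono (fun v hv h => ?_) (fun u hu v hv h => ⟨h.ne, ?_⟩)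
  · exact Finset.mem_filter.2
      ⟨Finset.mem_powerset.2 (Finset.singleton_subset_iff.2 hv), Or.inl ⟨v, h, rfl⟩⟩
  · exact Finset.mem_filter.2 ⟨Finset.mem_powerset.2
      (Finset.insert_subset hu (Finset.singleton_subset_iff.2 hv)), Or.inr ⟨u, v, h, rfl⟩⟩

lemma lubell_le_markedLubell_of_isSubgraph {A : Set V} {Γ : SimpleGraph V} {S : Finset V}
    {H : FinHypergraph V} (hH : H.IsSubgraph (ofMarked A Γ S)) :
    H.lubell ≤ markedLubell A Γ H.verts := by
  rw [lubell_eq_markedLubell ((ofMarked_isRGraph A Γ S).of_isSubgraph hH)]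
  refine markedLubell_mono (fun v _ h => ?_) (fun u _ v _ h => ?_)
  · rcases (Finset.mem_filter.1 (hH.2 h)).2 with ⟨w, hw, he⟩ | ⟨u, w, hw, he⟩
    · rwa [Finset.singleton_injective he]
    · have := congrArg Finset.card he
      rw [Finset.card_singleton, Finset.card_pair hw.ne] at this
      omega
  · rcases (Finset.mem_filter.1 (hH.2 h.2)).2 with ⟨w, hw, he⟩ | ⟨x, y, hxy, he⟩
    · have := congrArg Finset.card he
      rw [Finset.card_singleton, Finset.card_pair h.1] at this
      omega
    · have hu : u ∈ ({x, y} : Finset V) := by rw [← he]; simp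
      have hv : v ∈ ({x, y} : Finset V) := by rw [← he]; simp
      simp only [Finset.mem_insert, Finset.mem_singleton] at hu hv
      rcases hu with rfl | rfl <;> rcases hv with rfl | rfl
      · exact (h.1 rfl).elim
      · exact hxy
      · exact hxy.symm
      · exact (h.1 rfl).elim

end FinHypergraph

open FinHypergraph

/-- If no clique density lies in `(γ, β)`, then every large `{1, 2}`-graph whose Lubell function
exceeds `γ` by a fixed amount has a subgraph on `t` vertices with Lubell function at least `β`. -/
theorem exists_isSubgraph_lubell_ge {γ β ε : ℝ} (hε : 0 < ε)
    (hgap : ∀ a b : ℕ, 1 ≤ a + b → γ < cliqueDensity a b → β ≤ cliqueDensity a b)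
    {t : ℕ} (ht : 2 ≤ t) :
    ∃ n₀ : ℕ, ∀ n : ℕ, n₀ ≤ n → ∀ (V : Type) (G : FinHypergraph V),
      G.IsRGraph {1, 2} → G.verts.card = n → γ + ε ≤ G.lubell →
        ∃ H : FinHypergraph V, H.IsSubgraph G ∧ H.verts.card = t ∧ β ≤ H.lubell := by
  obtain ⟨n₀, h⟩ := exists_finset_markedLubell_ge hε hgap ht
  refine ⟨n₀, fun n hn V G hG hGn hle => ?_⟩
  let f : {v // v ∈ G.verts} ↪ V := Function.Embedding.subtype _
  have huniv : (Finset.univ : Finset {v // v ∈ G.verts}).map f = G.verts := by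
    rw [Finset.univ_eq_attach]; exact Finset.attach_map_val
  obtain ⟨T, hT, hTle⟩ := h {v // v ∈ G.verts} (by rw [Fintype.card_coe, hGn]; exact hn)
    (f ⁻¹' G.marked) (G.graph.comap f) (by
      rwa [markedLubell_map, huniv, ← lubell_eq_markedLubell hG])
  have hsub : T.map f ⊆ G.verts := by
    exact (Finset.map_subset_map.2 (Finset.subset_univ T)).trans huniv.subset
  rw [markedLubell_map] at hTle
  exact ⟨G.induce (T.map f), G.induce_isSubgraph hsub, (Finset.card_map f).trans hT,
    hTle.trans (markedLubell_le_lubell_induce hG hsub)⟩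

lemma two_le_of_forall_mem_le {t : ℕ} (ht : ∀ r ∈ ({1, 2} : Finset ℕ), r ≤ t) : 2 ≤ t :=
  ht 2 (by simp)

/-- The jump constant does not depend on `ε`: it is the gap above `α` in the set of clique
densities, which is well-ordered. -/
theorem isJump_one_two {α : ℝ} (hα : α ∈ Set.Icc (0 : ℝ) 2) : IsJump {1, 2} α := by
  refine ⟨by simpa using hα, ?_⟩
  obtain ⟨c, hc, hgap⟩ := exists_gap_above_cliqueDensity α
  exact ⟨c, hc, fun ε hε t ht =>
    exists_isSubgraph_lubell_ge hε hgap (two_le_of_forall_mem_le ht)⟩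

/-- Outside the closed set `weakJumpValues` there is a neighbourhood of `α` without clique
densities. -/
theorem isStrongJump_one_two {α : ℝ} (hα : α ∈ Set.Icc (0 : ℝ) 2) (hW : α ∉ weakJumpValues) :
    IsStrongJump {1, 2} α := by
  refine ⟨by simpa using hα, ?_⟩
  obtain ⟨c, hc, hball⟩ := Metric.isOpen_iff.1 isClosed_weakJumpValues.isOpen_compl α hW
  refine ⟨c / 2, by positivity, fun t ht => ?_⟩
  obtain ⟨n₀, h⟩ := exists_isSubgraph_lubell_ge (γ := α - c) (β := α + c / 2) (ε := c / 2)
    (by positivity) (fun a b hab hlt => by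
      by_contra! hlt'
      refine hball ?_ (cliqueDensity_mem_weakJumpValues hab)
      rw [Metric.mem_ball, Real.dist_eq, abs_lt]
      constructor <;> linarith) (two_le_of_forall_mem_le ht)
  exact ⟨n₀, fun n hn V G hG hGn hle => h n hn V G hG hGn (by linarith)⟩

/-! ### Weak jumps are not strong -/

/-- The infinite blow-up of a clique on `I`: each vertex is replaced by an infinite independent
set. -/
def infiniteBlowup (I : Type*) : SimpleGraph (I × ℕ) := (⊤ : SimpleGraph I).comap Prod.fst

/-- In a blow-up of a clique with vertex set `I` and set `B` of marked vertices, large sets of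
vertices have Lubell function at most about the density of the clique, because every clique of the
blow-up has at most one vertex in each part. -/
lemma markedLubell_infiniteBlowup_le {I : Type*} [Fintype I] (B : Set I) (S : Finset (I × ℕ))
    (hS : 2 ≤ S.card) :
    markedLubell (Prod.fst ⁻¹' B) (infiniteBlowup I) S ≤
      cliqueDensity (Finset.univ.filter (· ∈ B)).card (Finset.univ.filter (· ∉ B)).card +
        1 / S.card := by
  obtain ⟨C, -, hC0, hC, hle⟩ := exists_isClique_markedLubell_le
    (Prod.fst ⁻¹' B) (infiniteBlowup I) S hS
  have hinj : Set.InjOn Prod.fst (C : Set (I × ℕ)) := fun u hu v hv huv => by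
    by_contra hne
    exact hC hu hv hne huv
  refine hle.trans (add_le_add_left (cliqueDensity_mono ?_ ?_ ?_) _)
  · rw [Finset.card_filter_add_card_filter_not]
    exact Finset.card_pos.2 hC0
  all_goals
    refine Finset.card_le_card_of_injOn Prod.fst (fun v hv => ?_)
      (hinj.mono fun v hv => (Finset.mem_filter.1 (Finset.mem_coe.1 hv)).1)
    exact Finset.mem_coe.2 (Finset.mem_filter.2
      ⟨Finset.mem_univ _, (Finset.mem_filter.1 (Finset.mem_coe.1 hv)).2⟩)

lemma exists_le_markedLubell_infiniteBlowup {I : Type*} [Fintype I] (B : Set I) {a b : ℕ}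
    (ha : (Finset.univ.filter (· ∈ B)).card = a) (hb : (Finset.univ.filter (· ∉ B)).card = b)
    (hab : 1 ≤ a + b) {q : ℕ} (hq : 2 ≤ q) :
    ∃ S : Finset (I × ℕ), q ≤ S.card ∧
      cliqueDensity a b ≤ markedLubell (Prod.fst ⁻¹' B) (infiniteBlowup I) S := by
  let P : I → Finset (I × ℕ) := fun i => {i} ×ˢ Finset.range (cliqueWeight a b (i ∈ B) * q)
  have hP : ∀ i, ∀ v ∈ P i, v.1 = i := fun i v hv => by
    simpa using (Finset.mem_product.1 hv).1
  refine ⟨_, cliqueDensity_le_markedLubell_biUnion B Finset.univ (Prod.fst ⁻¹' B)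
    (infiniteBlowup I) P ha hb hab (fun i _ => by simp [P]) ?_ ?_ hq⟩
  · intro i _ hi v hv
    rwa [Set.mem_preimage, hP i v hv]
  · intro i _ j _ hij u hu v hv
    change u.1 ≠ v.1
    rwa [hP i u hu, hP j v hv]

lemma exists_fintype_set_card (a b : ℕ) : ∃ (I : Type) (_ : Fintype I) (B : Set I),
    (Finset.univ.filter (· ∈ B)).card = a ∧ (Finset.univ.filter (· ∉ B)).card = b := by
  obtain ⟨B, hB⟩ : ∃ B : Set (Fin a ⊕ Fin b), B = Set.range Sum.inl := ⟨_, rfl⟩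
  have hl : (Finset.univ : Finset (Fin a ⊕ Fin b)).filter (· ∈ B) =
      Finset.univ.map ⟨Sum.inl, Sum.inl_injective⟩ := by ext (x | x) <;> simp [hB]
  have hr : (Finset.univ : Finset (Fin a ⊕ Fin b)).filter (· ∉ B) =
      Finset.univ.map ⟨Sum.inr, Sum.inr_injective⟩ := by ext (x | x) <;> simp [hB]
  exact ⟨Fin a ⊕ Fin b, inferInstance, B, by rw [hl]; simp, by rw [hr]; simp⟩

/-- A blow-up of a clique whose density is close to `α` reaches Lubell function about `α`, and none
of its large subgraphs is noticeably denser. -/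
theorem not_isStrongJump_one_two {α : ℝ} (hα : α ∈ weakJumpValues) : ¬ IsStrongJump {1, 2} α := by
  rintro ⟨-, c, hc, h⟩
  obtain ⟨a, b, hab, hnear⟩ := exists_cliqueDensity_near hα (half_pos hc)
  rw [abs_lt] at hnear
  obtain ⟨k, hk⟩ := exists_nat_gt (2 / c)
  have htc : 1 / ((max 2 k : ℕ) : ℝ) ≤ c / 2 := by
    have : 2 / c ≤ ((max 2 k : ℕ) : ℝ) := hk.le.trans (by exact_mod_cast le_max_right 2 k)
    refine (one_div_le_one_div_of_le (by positivity) this).trans ?_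
    rw [one_div_div]
  have ht : 2 ≤ max 2 k := le_max_left _ _
  obtain ⟨n₀, hn₀⟩ := h (max 2 k) (by
    intro r hr
    simp only [Finset.mem_insert, Finset.mem_singleton] at hr
    omega)
  obtain ⟨I, _, B, ha, hb⟩ := exists_fintype_set_card a b
  obtain ⟨S, hqS, hS⟩ := exists_le_markedLubell_infiniteBlowup B ha hb hab (le_max_left 2 n₀)
  obtain ⟨H, hH, hHt, hle⟩ := hn₀ S.card ((le_max_right 2 n₀).trans hqS) _
    (ofMarked (Prod.fst ⁻¹' B) (infiniteBlowup I) S) (ofMarked_isRGraph _ _ _) rfl (by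
      linarith [hS.trans (markedLubell_le_lubell_ofMarked _ _ _)])
  have h1 := lubell_le_markedLubell_of_isSubgraph hH
  have h2 := markedLubell_infiniteBlowup_le B H.verts (by rw [hHt]; exact ht)
  rw [hHt, ha, hb] at h2
  linarith
end

theorem theorem3 :
    (∀ α ∈ Set.Icc (0 : ℝ) 2, IsJump {1, 2} α) ∧
    (∀ α : ℝ, IsWeakJump {1, 2} α ↔ α ∈ weakJumpValues) ∧
    (∀ α ∈ Set.Icc (0 : ℝ) 2, α ∉ weakJumpValues → IsStrongJump {1, 2} α) := by
  refine ⟨fun α hα => isJump_one_two hα, fun α => ⟨fun h => ?_, fun h => ?_⟩,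
    fun α hα hW => isStrongJump_one_two hα hW⟩
  · by_contra hW
    exact h.2 (isStrongJump_one_two (by simpa using h.1.1) hW)
  · exact ⟨isJump_one_two (weakJumpValues_subset_Icc h), not_isStrongJump_one_two h⟩
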